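/- Let $G$ be a finite group and let $\pi:G\to \mathrm{GL}_p(\mathbb C)$ be a representation of $G$ by unitary matrices (for example a permutation representation). Let $\mathrm{Op}\in M_{p\times p}(\mathbb C)$ be $\pi$-symmetric, i.e. $\pi(g)\,\mathrm{Op}=\mathrm{Op}\,\pi(g)$ for all $g\in G$. For a representation $\rho:G\to \mathrm{GL}_r(\mathbb C)$ let $$\mathcal K_G(\rho,\pi):=\bigcap_{g\in G}\ker\left[I_r\otimes\pi(g)-\rho(g)^{T}\otimes I_p\right]\subseteq\mathbb C^r\otimes\mathbb C^p ,\qquad d=\dim \mathcal K_G(\rho,\pi),$$ and define a quotient operator of $\mathrm{Op}$ with respect to $\rho$ to be $$\mathrm{Op}_\rho:=\Theta^{*}\,[I_r\otimes \mathrm{Op}]\,\Theta\in M_{d\times d}(\mathbb C),$$ where $\Theta\in M_{rp\times d}(\mathbb C)$ is any matrix whose columns form an orthonormal basis of $\mathcal K_G(\rho,\pi)$. For a subgroup $H\le G$ and a representation $\sigma$ of $H$, $\mathrm{Op}_\sigma$ is defined in the same way from $H$, $\sigma$ and the restriction $\pi|_H$. For operators write $A\cong B$ if $A$ and $B$ are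 unitarily equivalent. Then, for all choices of the matrices $\Theta$ that define the quotient operators, the following hold. (1) If a representation $R$ of $G$ is equivalent to a finite direct sum $\bigoplus_{i}\rho_i$ of (possibly repeating and not necessarily irreducible) representations $\rho_i$ of $G$, then $\mathrm{Op}_R\cong\bigoplus_{i}\mathrm{Op}_{\rho_i}$. (2) Let $H$ be a subgroup of $G$ and $\sigma$ a representation of $H$. If the representation $\rho$ of $G$ is equivalent to the induced representation $\mathrm{Ind}_H^G\sigma$, then $\mathrm{Op}_\sigma\cong\mathrm{Op}_\rho$. (3) Let $\mathrm{reg}_G$ be (a matrix form of) the regular representation of $G$, and let $(\rho_i)_{i\in I}$ contain every irreducible complex representation of $G$ exactly once up to equivalence. Then $I$ is finite and $$\mathrm{Op}\cong\mathrm{Op}_{\mathrm{reg}_G}\cong\bigoplus_{i\in I}\left[I_{\deg\rho_i}\otimes\mathrm{Op}_{\rho_i}\right].$$ -/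

import Mathlib

open scoped Kronecker

noncomputable section

/-- The representation on `ℂ^r` given by a homomorphism from `G` to the invertible `r × r`
complex matrices. -/
def matRep {G : Type*} [Group G] {r : ℕ} (ρ : G →* Matrix.GeneralLinearGroup (Fin r) ℂ) :
    Representation ℂ G (Fin r → ℂ) :=
  (Matrix.toLinAlgEquiv' : Matrix (Fin r) (Fin r) ℂ ≃ₐ[ℂ] _).toMonoidHom.comp
    ((Units.coeHom (Matrix (Fin r) (Fin r) ℂ)).comp ρ)

/-- `Op` is `π`-symmetric: it commutes with every `π g`. -/
def IsPiSymmetric {G : Type*} [Group G] {p : ℕ}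
    (π : G →* Matrix.GeneralLinearGroup (Fin p) ℂ) (Op : Matrix (Fin p) (Fin p) ℂ) : Prop :=
  ∀ g : G, (π g : Matrix (Fin p) (Fin p) ℂ) * Op = Op * (π g : Matrix (Fin p) (Fin p) ℂ)

/-- The kernel space `⋂ g, ker (I_r ⊗ π g - (ρ g)ᵀ ⊗ I_p)`, as a subspace of the Hilbert space
`ℂ^r ⊗ ℂ^p`, whose coordinates are indexed by `Fin r × Fin p`. -/
def kernelSpace {G : Type*} [Group G] {r p : ℕ}
    (ρ : G →* Matrix.GeneralLinearGroup (Fin r) ℂ)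
    (π : G →* Matrix.GeneralLinearGroup (Fin p) ℂ) :
    Submodule ℂ (EuclideanSpace ℂ (Fin r × Fin p)) :=
  ⨅ g : G, LinearMap.ker (Matrix.toEuclideanLin
    ((1 : Matrix (Fin r) (Fin r) ℂ) ⊗ₖ (π g : Matrix (Fin p) (Fin p) ℂ)
      - (ρ g : Matrix (Fin r) (Fin r) ℂ).transpose ⊗ₖ (1 : Matrix (Fin p) (Fin p) ℂ)))

/-- The `rp × d` matrix `Θ` whose columns are the members of an orthonormal basis of the
kernel space. -/
def thetaMatrix {G : Type*} [Group G] {r p d : ℕ}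
    {ρ : G →* Matrix.GeneralLinearGroup (Fin r) ℂ}
    {π : G →* Matrix.GeneralLinearGroup (Fin p) ℂ}
    (b : OrthonormalBasis (Fin d) ℂ (kernelSpace ρ π)) :
    Matrix (Fin r × Fin p) (Fin d) ℂ :=
  Matrix.of fun x k => (b k : EuclideanSpace ℂ (Fin r × Fin p)) x

/-- The quotient operator `Op_ρ = Θ* (I_r ⊗ Op) Θ` for the orthonormal basis `b` of the kernel
space (`Θ` has the members of `b` as its columns). -/
def quotientOp {G : Type*} [Group G] {r p d : ℕ}
    {ρ : G →* Matrix.GeneralLinearGroup (Fin r) ℂ}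
    {π : G →* Matrix.GeneralLinearGroup (Fin p) ℂ}
    (Op : Matrix (Fin p) (Fin p) ℂ) (b : OrthonormalBasis (Fin d) ℂ (kernelSpace ρ π)) :
    Matrix (Fin d) (Fin d) ℂ :=
  (thetaMatrix b).conjTranspose * ((1 : Matrix (Fin r) (Fin r) ℂ) ⊗ₖ Op) * thetaMatrix b

/-- Unitary equivalence of square complex matrices, possibly with different index sets (which
then have equally many elements). -/
def UnitarilyEquivalent {m n : Type*} [Fintype m] [Fintype n] [DecidableEq m] [DecidableEq n]
    (A : Matrix m m ℂ) (B : Matrix n n ℂ) : Prop :=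
  ∃ U : Matrix m n ℂ, U.conjTranspose * U = 1 ∧ U * U.conjTranspose = 1 ∧
    A = U * B * U.conjTranspose

/-- The family `ρ` contains every irreducible complex representation of `G` exactly once up to
equivalence. -/
structure IsCompleteIrreps {G : Type*} [Group G] {ι : Type*} {r : ι → ℕ}
    (ρ : ∀ i, G →* Matrix.GeneralLinearGroup (Fin (r i)) ℂ) : Prop where
  irreducible : ∀ i, (matRep (ρ i)).IsIrreducible
  inequivalent : ∀ i j, Nonempty ((matRep (ρ i)).Equiv (matRep (ρ j))) → i = j
  complete : ∀ (n : ℕ) (τ : G →* Matrix.GeneralLinearGroup (Fin n) ℂ),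
    (matRep τ).IsIrreducible → ∃ i, Nonempty ((matRep τ).Equiv (matRep (ρ i)))

end

/-! Reshaping a vector of `kernelSpace ρ π` into a `p × r` matrix identifies that space with
Hom_G(ρ, π) (`kernelSpaceEquiv`). There `Op_ρ` is the matrix of post-composition with `Op` in an
orthonormal basis (`toMatrix_homBasis_llcomp`), so each claim reduces to an isomorphism of Hom
spaces natural in π: Hom(⊕ρ_i, π) = ∏ Hom(ρ_i, π) for (1), Frobenius reciprocity for (2), and
evaluation at the identity, Hom(ℂ[G], π) = π, for the first half of (3). The second half is the
isotypic decomposition π = ⊕ V_i ⊗ Hom(V_i, π), on which `Op` acts through the second factors only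
(`IsCompleteIrreps.toMatrix_evalBasis`).

These isomorphisms need not be isometric. Since π is unitary, the adjoint of `Op` is π-symmetric as
well, so by naturality they intertwine both post-composition with `Op` and its adjoint. The unitary
factor in the polar decomposition of such an intertwiner still intertwines
(`UnitarilyEquivalent.of_intertwining`). -/

noncomputable section

/-! ### Unitary equivalence from polar decomposition -/

section UnitaryEquivalence

open scoped ComplexOrder MatrixOrder Matrix.Norms.L2Operator

variable {m n : Type*} [Fintype m] [Fintype n] [DecidableEq n]

/-- The positive square root comes from the continuous functional calculus, hence commutes with
everything that commutes with its square. -/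
theorem Matrix.exists_isHermitian_mul_self_eq_conjTranspose_mul_self (X : Matrix m n ℂ) :
    ∃ S : Matrix n n ℂ, S.IsHermitian ∧ S * S = X.conjTranspose * X ∧
      ∀ B, Commute (X.conjTranspose * X) B → Commute S B := by
  have hP : 0 ≤ X.conjTranspose * X := (Matrix.posSemidef_conjTranspose_mul_self X).nonneg
  refine ⟨CFC.sqrt (X.conjTranspose * X), (CFC.sqrt_nonneg _).isSelfAdjoint,
    CFC.sqrt_mul_sqrt_self _ hP, fun B hB => ?_⟩
  rw [CFC.sqrt_eq_cfc]
  exact hB.cfc_nnreal _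

variable [DecidableEq m]

/-- An invertible matrix intertwining two matrices and their adjoints can be replaced by its
unitary polar factor. -/
theorem UnitarilyEquivalent.of_intertwining {A : Matrix m m ℂ} {B : Matrix n n ℂ}
    (X : Matrix m n ℂ) (Y : Matrix n m ℂ) (hXY : X * Y = 1) (hYX : Y * X = 1)
    (h : A * X = X * B) (h' : A.conjTranspose * X = X * B.conjTranspose) :
    UnitarilyEquivalent A B := by
  obtain ⟨S, hS, hSS, hcomm⟩ := X.exists_isHermitian_mul_self_eq_conjTranspose_mul_self
  have hXB : X.conjTranspose * A = B * X.conjTranspose := by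
    simpa using congrArg Matrix.conjTranspose h'
  -- Both intertwining relations enter: X*XB = X*AX = BX*X.
  have hSB : S * B = B * S := hcomm B (by
    rw [Commute, SemiconjBy, Matrix.mul_assoc, ← h, ← Matrix.mul_assoc, hXB, Matrix.mul_assoc])
  have hYX' : X.conjTranspose * Y.conjTranspose = 1 := by
    simpa using congrArg Matrix.conjTranspose hYX
  have hXY' : Y.conjTranspose * X.conjTranspose = 1 := by
    simpa using congrArg Matrix.conjTranspose hXY
  -- As YY* inverts X*X = S², this T is the inverse of S, and XT is the unitary polar factor of X.
  set T : Matrix n n ℂ := S * (Y * Y.conjTranspose) with hT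
  have hST : S * T = 1 := by
    rw [hT, ← Matrix.mul_assoc, hSS, Matrix.mul_assoc, ← Matrix.mul_assoc X Y, hXY,
      Matrix.one_mul, hYX']
  have hTS : T * S = 1 := mul_eq_one_comm.mp hST
  have hTh : T.conjTranspose = T := by
    have h1 : T.conjTranspose * S = 1 := by
      simpa [hS.eq] using congrArg Matrix.conjTranspose hST
    calc T.conjTranspose = T.conjTranspose * (S * T) := by rw [hST, Matrix.mul_one]
      _ = T := by rw [← Matrix.mul_assoc, h1, Matrix.one_mul]
  have hTB : T * B = B * T := by
    calc T * B = T * (B * (S * T)) := by rw [hST, Matrix.mul_one]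
      _ = T * (S * B) * T := by rw [hSB, Matrix.mul_assoc T, Matrix.mul_assoc B]
      _ = B * T := by rw [← Matrix.mul_assoc T, hTS, Matrix.one_mul]
  have hU : X * T * (X * T).conjTranspose = 1 := by
    have hTT : T * T = Y * Y.conjTranspose := by
      rw [hT, ← Matrix.mul_assoc, ← hT, hTS, Matrix.one_mul]
    rw [Matrix.conjTranspose_mul, hTh, Matrix.mul_assoc, ← Matrix.mul_assoc T, hTT,
      Matrix.mul_assoc, hXY', Matrix.mul_one, hXY]
  refine ⟨X * T, ?_, hU, ?_⟩
  · rw [Matrix.conjTranspose_mul, hTh, Matrix.mul_assoc, ← Matrix.mul_assoc _ X, ← hSS,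
      Matrix.mul_assoc S S, hST, Matrix.mul_one, hTS]
  · calc A = A * (X * T * (X * T).conjTranspose) := by rw [hU, Matrix.mul_one]
      _ = A * X * T * (X * T).conjTranspose := by simp only [Matrix.mul_assoc]
      _ = X * T * B * (X * T).conjTranspose := by
        rw [h, Matrix.mul_assoc X B, ← hTB, ← Matrix.mul_assoc]

/-- Two pairs of operators which are conjugate under a linear equivalence, and are represented in
suitable bases by a matrix and its adjoint, give unitarily equivalent matrices. -/
theorem UnitarilyEquivalent.of_linearEquiv {V W : Type*} [AddCommGroup V] [Module ℂ V]
    [AddCommGroup W] [Module ℂ W] (e : V ≃ₗ[ℂ] W) {S S' : Module.End ℂ V} {T T' : Module.End ℂ W}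
    (h : ∀ x, e (S x) = T (e x)) (h' : ∀ x, e (S' x) = T' (e x))
    (u : Module.Basis m ℂ V) (v : Module.Basis n ℂ W) {A : Matrix m m ℂ} {B : Matrix n n ℂ}
    (hA : LinearMap.toMatrix u u S = A) (hA' : LinearMap.toMatrix u u S' = A.conjTranspose)
    (hB : LinearMap.toMatrix v v T = B) (hB' : LinearMap.toMatrix v v T' = B.conjTranspose) :
    UnitarilyEquivalent A B := by
  have key {S : Module.End ℂ V} {T : Module.End ℂ W} (h : ∀ x, e (S x) = T (e x)) :
      LinearMap.toMatrix u u S * LinearMap.toMatrix v u (e.symm : W →ₗ[ℂ] V) =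
        LinearMap.toMatrix v u (e.symm : W →ₗ[ℂ] V) * LinearMap.toMatrix v v T := by
    rw [← LinearMap.toMatrix_comp, ← LinearMap.toMatrix_comp]
    congr 1
    ext w
    apply e.injective
    simp [h]
  refine .of_intertwining (LinearMap.toMatrix v u (e.symm : W →ₗ[ℂ] V))
    (LinearMap.toMatrix u v (e : V →ₗ[ℂ] W)) ?_ ?_ ?_ ?_
  · rw [← LinearMap.toMatrix_comp]; simp
  · rw [← LinearMap.toMatrix_comp]; simp
  · rw [← hA, ← hB, key h]
  · rw [← hA', ← hB', key h']

end UnitaryEquivalence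

/-! ### The kernel space as a space of intertwining maps -/

section KernelSpace

variable {G : Type*} [Group G] {r p : ℕ}

theorem matRep_eq_toLin' (ρ : G →* Matrix.GeneralLinearGroup (Fin r) ℂ) (g : G) :
    matRep ρ g = Matrix.toLin' (ρ g : Matrix (Fin r) (Fin r) ℂ) := rfl

/-- Once f is reshaped into a matrix, the transpose in `(ρ g)ᵀ ⊗ I` becomes right multiplication by
`ρ g`. -/
theorem mem_kernelSpace_iff {ρ : G →* Matrix.GeneralLinearGroup (Fin r) ℂ}
    {π : G →* Matrix.GeneralLinearGroup (Fin p) ℂ} {f : EuclideanSpace ℂ (Fin r × Fin p)} :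
    f ∈ kernelSpace ρ π ↔ ∀ g,
      (Matrix.of fun a i => f (i, a) : Matrix (Fin p) (Fin r) ℂ) *
        (ρ g : Matrix (Fin r) (Fin r) ℂ) =
      (π g : Matrix (Fin p) (Fin p) ℂ) *
        (Matrix.of fun a i => f (i, a) : Matrix (Fin p) (Fin r) ℂ) := by
  simp only [kernelSpace, Submodule.mem_iInf, LinearMap.mem_ker, map_sub, LinearMap.sub_apply,
    sub_eq_zero]
  refine forall_congr' fun g => ?_
  rw [eq_comm, ← Matrix.ext_iff, PiLp.ext_iff, Prod.forall, forall_comm]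
  refine forall₂_congr fun a i => ?_
  simp [Matrix.toLpLin_apply, Matrix.mulVec, dotProduct, Matrix.mul_apply,
    Fintype.sum_prod_type, Matrix.one_apply, mul_comm]

/-- The kernel space of `ρ` and `π` is the space of intertwining maps from `ρ` to `π`. -/
def kernelSpaceEquiv (ρ : G →* Matrix.GeneralLinearGroup (Fin r) ℂ)
    (π : G →* Matrix.GeneralLinearGroup (Fin p) ℂ) :
    kernelSpace ρ π ≃ₗ[ℂ] (matRep ρ).IntertwiningMap (matRep π) where
  toFun f := ⟨Matrix.toLin' (Matrix.of fun a i =>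
      (f : EuclideanSpace ℂ (Fin r × Fin p)) (i, a) : Matrix (Fin p) (Fin r) ℂ),
    fun g => by
      rw [matRep_eq_toLin', matRep_eq_toLin', ← Matrix.toLin'_mul, ← Matrix.toLin'_mul,
        mem_kernelSpace_iff.mp f.2 g]⟩
  map_add' f f' := by
    ext; simp [Matrix.mulVec, dotProduct, Pi.single_apply]
  map_smul' c f := by
    ext; simp [Matrix.mulVec, dotProduct, Pi.single_apply]
  invFun φ := ⟨WithLp.toLp 2 fun x => LinearMap.toMatrix' φ.toLinearMap x.2 x.1,
    mem_kernelSpace_iff.mpr fun g => by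
      have := congrArg LinearMap.toMatrix' (φ.isIntertwining' g)
      rwa [LinearMap.toMatrix'_comp, LinearMap.toMatrix'_comp, matRep_eq_toLin',
        matRep_eq_toLin', LinearMap.toMatrix'_toLin', LinearMap.toMatrix'_toLin'] at this⟩
  left_inv f := by ext x; simp
  right_inv φ := by ext; simp

theorem kernelSpaceEquiv_apply {ρ : G →* Matrix.GeneralLinearGroup (Fin r) ℂ}
    {π : G →* Matrix.GeneralLinearGroup (Fin p) ℂ} (f : kernelSpace ρ π) (v : Fin r → ℂ)
    (a : Fin p) : kernelSpaceEquiv ρ π f v a =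
      ∑ i, (f : EuclideanSpace ℂ (Fin r × Fin p)) (i, a) * v i := by
  simp [kernelSpaceEquiv, Matrix.mulVec, dotProduct]

/-- A `π`-symmetric matrix is an endomorphism of the representation `π`. -/
def IsPiSymmetric.intertwiningMap {π : G →* Matrix.GeneralLinearGroup (Fin p) ℂ}
    {M : Matrix (Fin p) (Fin p) ℂ} (hM : IsPiSymmetric π M) :
    (matRep π).IntertwiningMap (matRep π) :=
  ⟨Matrix.toLin' M, fun g => by
    rw [matRep_eq_toLin', ← Matrix.toLin'_mul, ← Matrix.toLin'_mul, hM g]⟩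

@[simp]
theorem IsPiSymmetric.intertwiningMap_apply {π : G →* Matrix.GeneralLinearGroup (Fin p) ℂ}
    {M : Matrix (Fin p) (Fin p) ℂ} (hM : IsPiSymmetric π M) (v : Fin p → ℂ) :
    hM.intertwiningMap v = M.mulVec v := rfl

/-- The only use of unitarity: π(g⁻¹) = π(g)*, so the adjoint of the relation at g⁻¹ is the relation
wanted at g. -/
theorem IsPiSymmetric.conjTranspose {π : G →* Matrix.GeneralLinearGroup (Fin p) ℂ}
    (hπ : ∀ g : G, (π g : Matrix (Fin p) (Fin p) ℂ) ∈ Matrix.unitaryGroup (Fin p) ℂ)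
    {M : Matrix (Fin p) (Fin p) ℂ} (hM : IsPiSymmetric π M) :
    IsPiSymmetric π M.conjTranspose := by
  intro g
  have hinv : ((π g⁻¹ : Matrix.GeneralLinearGroup (Fin p) ℂ) : Matrix (Fin p) (Fin p) ℂ)
      = (π g : Matrix (Fin p) (Fin p) ℂ).conjTranspose := by
    have h1 : ((π g⁻¹ : Matrix.GeneralLinearGroup (Fin p) ℂ) : Matrix (Fin p) (Fin p) ℂ) *
        (π g : Matrix (Fin p) (Fin p) ℂ) = 1 := by
      rw [← Units.val_mul, ← map_mul]; simp
    have h2 : (π g : Matrix (Fin p) (Fin p) ℂ) * (π g : Matrix (Fin p) (Fin p) ℂ).conjTranspose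
        = 1 := Matrix.mem_unitaryGroup_iff.mp (hπ g)
    exact left_inv_eq_right_inv h1 h2
  have := congrArg Matrix.conjTranspose (hM g⁻¹)
  rw [Matrix.conjTranspose_mul, Matrix.conjTranspose_mul, hinv,
    Matrix.conjTranspose_conjTranspose] at this
  exact this.symm

theorem IsPiSymmetric.comp {π : G →* Matrix.GeneralLinearGroup (Fin p) ℂ} {H : Type*} [Group H]
    {M : Matrix (Fin p) (Fin p) ℂ} (hM : IsPiSymmetric π M) (φ : H →* G) :
    IsPiSymmetric (π.comp φ) M := fun h => hM (φ h)

variable {d : ℕ} {ρ : G →* Matrix.GeneralLinearGroup (Fin r) ℂ}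
  {π : G →* Matrix.GeneralLinearGroup (Fin p) ℂ}

/-- The basis of the space of intertwining maps given by an orthonormal basis of the kernel
space. -/
def homBasis (b : OrthonormalBasis (Fin d) ℂ (kernelSpace ρ π)) :
    Module.Basis (Fin d) ℂ ((matRep ρ).IntertwiningMap (matRep π)) :=
  b.toBasis.map (kernelSpaceEquiv ρ π)

theorem quotientOp_conjTranspose (M : Matrix (Fin p) (Fin p) ℂ)
    (b : OrthonormalBasis (Fin d) ℂ (kernelSpace ρ π)) :
    quotientOp M.conjTranspose b = (quotientOp M b).conjTranspose := by
  simp [quotientOp, Matrix.conjTranspose_mul, Matrix.conjTranspose_kronecker, Matrix.mul_assoc]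

open Representation.IntertwiningMap in
/-- The quotient operator is the matrix of post-composition on the space of intertwining maps. -/
theorem toMatrix_homBasis_llcomp {M : Matrix (Fin p) (Fin p) ℂ} (hM : IsPiSymmetric π M)
    (b : OrthonormalBasis (Fin d) ℂ (kernelSpace ρ π)) :
    LinearMap.toMatrix (homBasis b) (homBasis b) (llcomp _ _ _ hM.intertwiningMap) =
      quotientOp M b := by
  ext k l
  obtain ⟨w, hw⟩ := (kernelSpaceEquiv ρ π).surjective
    (llcomp _ _ _ hM.intertwiningMap (homBasis b l))
  -- Evaluation at standard basis vectors shows that w = (I ⊗ M) b_l.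
  have hw' (i : Fin r) (a : Fin p) : (w : EuclideanSpace ℂ (Fin r × Fin p)) (i, a) =
      ∑ c, M a c * (b l : EuclideanSpace ℂ (Fin r × Fin p)) (i, c) := by
    have h1 : kernelSpaceEquiv ρ π w (Pi.single i 1) a =
        M.mulVec (kernelSpaceEquiv ρ π (b l) (Pi.single i 1)) a := by
      rw [hw]
      simp [homBasis, ← comp_def]
    simpa [kernelSpaceEquiv_apply, Matrix.mulVec, dotProduct, Pi.single_apply] using h1
  -- Orthonormality turns the k-th coordinate of w into ⟨b_k, w⟩, an entry of Θ*(I ⊗ M)Θ.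
  rw [LinearMap.toMatrix_apply, ← hw, homBasis, Module.Basis.map_repr]
  simp only [LinearEquiv.trans_apply, LinearEquiv.symm_apply_apply,
    OrthonormalBasis.coe_toBasis_repr_apply, OrthonormalBasis.repr_apply_apply]
  rw [Submodule.coe_inner, PiLp.inner_apply, Fintype.sum_prod_type, quotientOp, Matrix.mul_assoc,
    Matrix.mul_apply, Fintype.sum_prod_type]
  refine Finset.sum_congr rfl fun i _ => Finset.sum_congr rfl fun a _ => ?_
  rw [hw']
  simp [thetaMatrix, Matrix.mul_apply, Fintype.sum_prod_type, Matrix.one_apply, mul_comm]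

end KernelSpace

/-! ### Natural isomorphisms between spaces of intertwining maps -/

section HomEquivalences

namespace Representation

variable {k G : Type*} [CommRing k] [Group G] {W : Type*} [AddCommGroup W] [Module k W]

/-- Pre-composition with an equivalence of representations. -/
def homCongrLeft {V V' : Type*} [AddCommGroup V] [Module k V] [AddCommGroup V'] [Module k V']
    {ρ : Representation k G V} {ρ' : Representation k G V'} (e : ρ.Equiv ρ')
    (σ : Representation k G W) : ρ'.IntertwiningMap σ ≃ₗ[k] ρ.IntertwiningMap σ where
  toFun f := f.comp e.toIntertwiningMap
  map_add' _ _ := rfl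
  map_smul' _ _ := rfl
  invFun f := f.comp e.symm.toIntertwiningMap
  left_inv f := by ext x; simp
  right_inv f := by ext x; simp

/-- The universal property of the direct sum of representations. -/
def homDirectSumEquiv {ι : Type*} [DecidableEq ι] {V : ι → Type*} [∀ i, AddCommGroup (V i)]
    [∀ i, Module k (V i)] (ρ : ∀ i, Representation k G (V i)) (σ : Representation k G W) :
    (directSum ρ).IntertwiningMap σ ≃ₗ[k] ∀ i, (ρ i).IntertwiningMap σ where
  toFun f i := ⟨f.toLinearMap ∘ₗ DirectSum.lof k ι V i, fun g => by
    ext x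
    simpa using f.isIntertwining _ _ g (DirectSum.lof k ι V i x)⟩
  map_add' _ _ := rfl
  map_smul' _ _ := rfl
  invFun f := ⟨DirectSum.toModule k ι W fun i => (f i).toLinearMap, fun g => by
    ext i x
    simpa using (f i).isIntertwining _ _ g x⟩
  left_inv f := by ext i x; simp
  right_inv f := by ext i x; simp

/-- Intertwining maps out of the left regular representation are determined by the image of the
identity element. -/
def homLeftRegularEquiv (σ : Representation k G W) :
    (leftRegular k G).IntertwiningMap σ ≃ₗ[k] W where
  toFun f := f (MonoidAlgebra.single 1 1)
  map_add' _ _ := rfl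
  map_smul' _ _ := rfl
  invFun w := ⟨(Finsupp.lift W k G fun g => σ g w) ∘ₗ
      (MonoidAlgebra.coeffLinearEquiv k).toLinearMap, fun g => by ext h; simp⟩
  left_inv f := by
    ext g
    simpa using (f.isIntertwining _ _ g (MonoidAlgebra.single 1 1)).symm
  right_inv w := by simp

/-- Frobenius reciprocity for intertwining maps out of an induced representation. -/
def homIndEquiv {H : Type*} [Group H] (φ : H →* G) {V : Type*} [AddCommGroup V] [Module k V]
    (ρ : Representation k H V) (σ : Representation k G W) :
    (ind φ ρ).IntertwiningMap σ ≃ₗ[k] ρ.IntertwiningMap (σ.comp φ) where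
  toFun f := ⟨f.toLinearMap ∘ₗ IndV.mk φ ρ 1, fun h => by
    ext x
    have := f.isIntertwining _ _ (φ h) (IndV.mk φ ρ 1 x)
    simp_all [← Coinvariants.mk_inv_tmul]⟩
  map_add' _ _ := rfl
  map_smul' _ _ := rfl
  -- In this model of induction the class of g ⊗ x is the translate by g⁻¹ of the class of 1 ⊗ x,
  -- which forces the factor `σ g⁻¹`.
  invFun f := ⟨Coinvariants.lift _
    (TensorProduct.lift <| (Finsupp.lift _ _ _ fun g => σ g⁻¹ ∘ₗ f.toLinearMap) ∘ₗ
      (MonoidAlgebra.coeffLinearEquiv k).toLinearMap)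
    fun h => by
      ext g x
      have := f.isIntertwining _ _ h x
      simp_all, fun g => by ext; simp⟩
  left_inv f := by
    ext g x
    simpa using (f.isIntertwining _ _ g⁻¹ (IndV.mk φ ρ 1 x)).symm
  right_inv f := by ext; simp

end Representation

end HomEquivalences

/-! ### Joint evaluation on simple modules, by Schur's lemma -/

section SimpleModules

variable {k R ι : Type*} [Field k] [Ring R] [Algebra k R] [Fintype ι]
  {V : ι → Type*} [∀ i, AddCommGroup (V i)] [∀ i, Module k (V i)] [∀ i, Module R (V i)]
  [∀ i, IsScalarTower k R (V i)]
  {W : Type*} [AddCommGroup W] [Module k W] [Module R W] [IsScalarTower k R W]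
  {κ : ι → Type*} [∀ i, Fintype (κ i)]

/-- The joint evaluation map of families of homomorphisms out of simple modules. -/
def evalSum (T : ∀ i, κ i → V i →ₗ[R] W) : (∀ i, κ i → V i) →ₗ[R] W :=
  ∑ i, ∑ j, T i j ∘ₗ LinearMap.proj j ∘ₗ LinearMap.proj i

@[simp]
theorem evalSum_apply (T : ∀ i, κ i → V i →ₗ[R] W) (x : ∀ i, κ i → V i) :
    evalSum T x = ∑ i, ∑ j, T i j (x i j) := by
  simp [evalSum]

/-- A semisimple W is the sum of its simple submodules. The inclusion of each, seen as a map out of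
some `V i`, is a combination of the `T i j`, so its image lies in the range. -/
theorem evalSum_surjective [IsSemisimpleModule R W]
    (hV : ∀ N : Submodule R W, IsSimpleModule R N → ∃ i, Nonempty (N ≃ₗ[R] V i))
    (T : ∀ i, κ i → V i →ₗ[R] W) (hT : ∀ i, ⊤ ≤ Submodule.span k (Set.range (T i))) :
    Function.Surjective (evalSum T) := by
  classical
  rw [← LinearMap.range_eq_top, eq_top_iff, ← IsSemisimpleModule.sSup_simples_eq_top R W]
  refine sSup_le fun N hN x hx => ?_
  obtain ⟨i, ⟨e⟩⟩ := hV N hN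
  obtain ⟨c, hc⟩ := (Submodule.mem_span_range_iff_exists_fun k).mp
    (hT i (Submodule.mem_top (x := N.subtype ∘ₗ e.symm.toLinearMap)))
  refine ⟨Pi.single i fun j => c j • e ⟨x, hx⟩, ?_⟩
  rw [evalSum_apply, Finset.sum_eq_single i]
  · have := DFunLike.congr_fun hc (e ⟨x, hx⟩)
    simpa [LinearMap.sum_apply, LinearMap.map_smul_of_tower] using this
  · intro i' _ hi'
    simp [Pi.single_eq_of_ne hi']
  · simp

variable [IsAlgClosed k] [∀ i, FiniteDimensional k (V i)] [∀ i, IsSimpleModule R (V i)]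

/-- A nonzero kernel would contain a simple N. By Schur's lemma N projects nontrivially only to
copies of a single `V i`, and there by scalars, which would give a linear relation among the `T i
j`. -/
theorem evalSum_injective (hV : ∀ i j, Nonempty (V i ≃ₗ[R] V j) → i = j)
    (T : ∀ i, κ i → V i →ₗ[R] W) (hT : ∀ i, LinearIndependent k (T i)) :
    Function.Injective (evalSum T) := by
  classical
  rw [← LinearMap.ker_eq_bot]
  refine (IsSemisimpleModule.eq_bot_or_exists_simple_le _).resolve_right ?_
  rintro ⟨N, hN, hsimple⟩
  have := IsSimpleModule.nontrivial R N
  obtain ⟨x, hx⟩ := exists_ne (0 : N)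
  obtain ⟨i, j, hij⟩ : ∃ i j, (x : ∀ i, κ i → V i) i j ≠ 0 := by
    by_contra! h
    exact hx (Subtype.ext (funext fun i => funext fun j => h i j))
  let P (i : ι) (j : κ i) : N →ₗ[R] V i := LinearMap.proj j ∘ₗ LinearMap.proj i ∘ₗ N.subtype
  have hP : P i j ≠ 0 := fun h => hij (DFunLike.congr_fun h x)
  let e : N ≃ₗ[R] V i := .ofBijective (P i j) (LinearMap.bijective_of_ne_zero hP)
  have hzero (i' : ι) (hi' : i' ≠ i) (j' : κ i') : P i' j' = 0 := by
    by_contra h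
    exact hi' (hV _ _ ⟨(LinearEquiv.ofBijective (P i' j')
      (LinearMap.bijective_of_ne_zero h)).symm.trans e⟩)
  have hscalar (j' : κ i) : ∃ c : k, ∀ v, P i j' (e.symm v) = c • v := by
    obtain ⟨c, hc⟩ := (IsSimpleModule.algebraMap_end_bijective_of_isAlgClosed k).2
      (P i j' ∘ₗ e.symm.toLinearMap)
    exact ⟨c, fun v => (DFunLike.congr_fun hc v).symm⟩
  choose c hc using hscalar
  have hsum : ∑ j', c j' • T i j' = 0 := by
    ext v
    have h0 : evalSum T (e.symm v : N) = 0 := hN (e.symm v).2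
    rw [evalSum_apply, Finset.sum_eq_single i] at h0
    · rw [LinearMap.zero_apply, ← h0, LinearMap.sum_apply]
      refine Finset.sum_congr rfl fun j' _ => ?_
      have : (e.symm v : ∀ i, κ i → V i) i j' = c j' • v := hc j' v
      rw [this, LinearMap.map_smul_of_tower, LinearMap.smul_apply]
    · intro i' _ hi'
      refine Finset.sum_eq_zero fun j' _ => ?_
      have : (e.symm v : ∀ i, κ i → V i) i' j' = 0 :=
        DFunLike.congr_fun (hzero i' hi' j') (e.symm v)
      rw [this, map_zero]
    · simp
  have hcj := Fintype.linearIndependent_iff.mp (hT i) c hsum j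
  have h1 : (P i j) x = c j • e x := by simpa using hc j (e x)
  rw [hcj, zero_smul] at h1
  exact hij h1

/-- Pairwise non-isomorphic simple modules over a semisimple ring form a finite
family. -/
theorem finite_of_simple_of_inequivalent {R ι : Type*} [Ring R] [IsSemisimpleRing R]
    (V : ι → Type*) [∀ i, AddCommGroup (V i)] [∀ i, Module R (V i)] [∀ i, IsSimpleModule R (V i)]
    (hV : ∀ i j, Nonempty (V i ≃ₗ[R] V j) → i = j) : Finite ι := by
  choose I e using fun i => IsSemisimpleRing.exists_linearEquiv_ideal_of_isSimpleModule R (V i)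
  have (i : ι) : IsSimpleModule R (I i) := .congr (e i).some.symm
  -- R has finitely many isotypic components, and the component of a minimal left ideal determines
  -- its isomorphism class.
  refine Finite.of_injective (β := isotypicComponents R R)
    (fun i => ⟨isotypicComponent R R (I i), I i, inferInstance, rfl⟩) fun i j hij => hV i j ?_
  have hle : I i ≤ isotypicComponent R R (I j) :=
    (I i).le_isotypicComponent.trans_eq (congrArg Subtype.val hij)
  obtain ⟨f⟩ := isIsotypicOfType_submodule_iff.mp (.isotypicComponent R R (I j)) _ hle
  exact ⟨(e i).some.trans (f.trans (e j).some.symm)⟩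

end SimpleModules

/-! ### Irreducible representations and the isotypic decomposition -/

section Irreps

open scoped MonoidAlgebra

open Representation

variable {G : Type*} [Group G]

/-- A finite-dimensional module over the group algebra is isomorphic to the module of a matrix
representation. -/
theorem exists_linearEquiv_matRep_asModule (N : Type*) [AddCommGroup N] [Module ℂ N]
    [Module ℂ[G] N] [IsScalarTower ℂ ℂ[G] N] [FiniteDimensional ℂ N] :
    ∃ (n : ℕ) (τ : G →* Matrix.GeneralLinearGroup (Fin n) ℂ),
      Nonempty (N ≃ₗ[ℂ[G]] (matRep τ).asModule) := by
  let β := Module.finBasis ℂ N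
  let τ : G →* Matrix.GeneralLinearGroup (Fin (Module.finrank ℂ N)) ℂ :=
    (Units.map (LinearMap.toMatrixAlgEquiv β).toMonoidHom).comp
      (ofModule' (k := ℂ) (G := G) N).toHomUnits
  have hτ (g : G) : (τ g : Matrix _ _ ℂ) = LinearMap.toMatrix β β (ofModule' N g) := rfl
  refine ⟨_, τ, ⟨.ofBijective (MonoidAlgebra.equivariantOfLinearOfComm
    (β.equivFun.trans (matRep τ).asModuleEquiv.symm).toLinearMap fun g v => ?_) ?_⟩⟩
  · rw [single_smul, one_smul]
    change ⇑(β.repr (ofModule' N g v)) = (τ g : Matrix _ _ ℂ).mulVec ⇑(β.repr v)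
    rw [hτ, LinearMap.toMatrix_mulVec_repr]
  · exact (β.equivFun.trans (matRep τ).asModuleEquiv.symm).bijective

theorem Representation.nonempty_equiv_of_asModule {k V W : Type*} [Field k] [AddCommGroup V]
    [Module k V] [AddCommGroup W] [Module k W] {ρ : Representation k G V}
    {σ : Representation k G W} (e : ρ.asModule ≃ₗ[k[G]] σ.asModule) : Nonempty (ρ.Equiv σ) :=
  ⟨((IntertwiningMap.equivLinearMapAsModule ρ σ).symm e.toLinearMap).ofBijective e.bijective⟩

theorem Representation.Equiv.nonempty_asModule {k V W : Type*} [Field k] [AddCommGroup V]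
    [Module k V] [AddCommGroup W] [Module k W] {ρ : Representation k G V}
    {σ : Representation k G W} (e : ρ.Equiv σ) : Nonempty (ρ.asModule ≃ₗ[k[G]] σ.asModule) :=
  ⟨.ofBijective (IntertwiningMap.equivLinearMapAsModule ρ σ e.toIntertwiningMap)
    e.toLinearEquiv.bijective⟩

variable {ι : Type*} {r : ι → ℕ} {ρ : ∀ i, G →* Matrix.GeneralLinearGroup (Fin (r i)) ℂ}

theorem IsCompleteIrreps.isSimpleModule (h : IsCompleteIrreps ρ) (i : ι) :
    IsSimpleModule ℂ[G] (matRep (ρ i)).asModule :=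
  (irreducible_iff_isSimpleModule_asModule _).mp (h.irreducible i)

theorem IsCompleteIrreps.eq_of_linearEquiv (h : IsCompleteIrreps ρ) (i j : ι)
    (e : Nonempty ((matRep (ρ i)).asModule ≃ₗ[ℂ[G]] (matRep (ρ j)).asModule)) : i = j :=
  h.inequivalent i j (nonempty_equiv_of_asModule e.some)

/-- Completeness is assumed for matrix representations only; a choice of basis extends it to
abstract simple modules. -/
theorem IsCompleteIrreps.exists_linearEquiv (h : IsCompleteIrreps ρ) (N : Type*) [AddCommGroup N]
    [Module ℂ N] [Module ℂ[G] N] [IsScalarTower ℂ ℂ[G] N] [FiniteDimensional ℂ N]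
    [IsSimpleModule ℂ[G] N] : ∃ i, Nonempty (N ≃ₗ[ℂ[G]] (matRep (ρ i)).asModule) := by
  obtain ⟨n, τ, ⟨e⟩⟩ := exists_linearEquiv_matRep_asModule (G := G) N
  obtain ⟨i, ⟨f⟩⟩ := h.complete n τ
    ((irreducible_iff_isSimpleModule_asModule _).mpr (.congr e.symm))
  obtain ⟨f'⟩ := f.nonempty_asModule
  exact ⟨i, ⟨e.trans f'⟩⟩

/-- By Maschke's theorem `ℂ[G]` is a semisimple ring. -/
theorem IsCompleteIrreps.finite [Finite G] (h : IsCompleteIrreps ρ) : Finite ι :=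
  have := h.isSimpleModule
  finite_of_simple_of_inequivalent (R := ℂ[G]) (fun i => (matRep (ρ i)).asModule)
    h.eq_of_linearEquiv

variable [Finite G] [Fintype ι] {p : ℕ} {π : G →* Matrix.GeneralLinearGroup (Fin p) ℂ} {d : ι → ℕ}

/-- Joint evaluation of bases of the spaces of intertwining maps out of all irreducible
representations is bijective. -/
theorem IsCompleteIrreps.bijective_evalSum (h : IsCompleteIrreps ρ)
    (T : ∀ i, Module.Basis (Fin (d i)) ℂ ((matRep (ρ i)).IntertwiningMap (matRep π))) :
    Function.Bijective (fun x : ∀ i, Fin (d i) → Fin (r i) → ℂ => ∑ i, ∑ k, T i k (x i k)) := by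
  have := h.isSimpleModule
  let T' (i : ι) := (T i).map (IntertwiningMap.equivLinearMapAsModule _ _)
  have key : ∀ x : ∀ i, Fin (d i) → (matRep (ρ i)).asModule,
      evalSum (fun i k => T' i k) x = ∑ i, ∑ k, T i k (x i k) := fun x => by
    rw [evalSum_apply]
    simp only [T', Module.Basis.map_apply]
    rfl
  have hbij : Function.Bijective (evalSum (fun i k => T' i k)) :=
    ⟨evalSum_injective h.eq_of_linearEquiv _ fun i => (T' i).linearIndependent,
      evalSum_surjective (k := ℂ) (fun N _ =>
        have : FiniteDimensional ℂ N := inferInstanceAs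
          (FiniteDimensional ℂ (N.restrictScalars ℂ))
        h.exists_linearEquiv N) _ fun i => (T' i).span_eq.ge⟩
  rw [funext key] at hbij
  exact hbij

/-- The basis of the representation space of `π` consisting of the values of bases of the spaces
of intertwining maps at the standard basis vectors of all irreducible representations. -/
def IsCompleteIrreps.evalBasis (h : IsCompleteIrreps ρ)
    (T : ∀ i, Module.Basis (Fin (d i)) ℂ ((matRep (ρ i)).IntertwiningMap (matRep π))) :
    Module.Basis (Σ i, Fin (r i) × Fin (d i)) ℂ (Fin p → ℂ) :=
  have hT := h.bijective_evalSum T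
  let e : (∀ i, Fin (d i) → Fin (r i) → ℂ) ≃ₗ[ℂ] (Fin p → ℂ) := .ofBijective
    { toFun x := ∑ i, ∑ k, T i k (x i k)
      map_add' x y := by simp [Finset.sum_add_distrib]
      map_smul' c x := by simp [Finset.smul_sum] } hT
  -- The product basis lists the multiplicity index first; the swap matches the order of factors in
  -- `I ⊗ Op_ρ`.
  ((Pi.basis fun i => Pi.basis fun _ : Fin (d i) => Pi.basisFun ℂ (Fin (r i))).reindex
    (Equiv.sigmaCongrRight fun i =>
      (Equiv.sigmaEquivProd (Fin (d i)) (Fin (r i))).trans (Equiv.prodComm _ _))).map e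

theorem IsCompleteIrreps.evalBasis_apply (h : IsCompleteIrreps ρ)
    (T : ∀ i, Module.Basis (Fin (d i)) ℂ ((matRep (ρ i)).IntertwiningMap (matRep π)))
    (i : ι) (a : Fin (r i)) (k : Fin (d i)) :
    h.evalBasis T ⟨i, a, k⟩ = T i k (Pi.single a 1) := by
  classical
  have : (Pi.basis fun i => Pi.basis fun _ : Fin (d i) => Pi.basisFun ℂ (Fin (r i)))
      ⟨i, k, a⟩ = Pi.single i (Pi.single k (Pi.single a (1 : ℂ))) := by
    rw [Pi.basis_apply, Pi.basis_apply, Pi.basisFun_apply]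
  simp only [evalBasis, Module.Basis.map_apply, Module.Basis.reindex_apply]
  change ∑ i', ∑ k', T i' k' ((Pi.basis fun i => Pi.basis fun _ : Fin (d i) =>
    Pi.basisFun ℂ (Fin (r i))) ⟨i, k, a⟩ i' k') = _
  rw [this, Finset.sum_eq_single i, Finset.sum_eq_single k]
  · simp
  · intro k' _ hk'
    simp [Pi.single_eq_of_ne hk']
  · simp
  · intro i' _ hi'
    simp [Pi.single_eq_of_ne hi']
  · simp

open IntertwiningMap in
-- Since φ(T e_a) = (φ ∘ T) e_a, expanding φ ∘ T in the basis of Hom(V_i, π) leaves i and a fixed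
-- and changes only the multiplicity index.
theorem IsCompleteIrreps.toMatrix_evalBasis [DecidableEq ι] (h : IsCompleteIrreps ρ)
    (T : ∀ i, Module.Basis (Fin (d i)) ℂ ((matRep (ρ i)).IntertwiningMap (matRep π)))
    (φ : (matRep π).IntertwiningMap (matRep π)) :
    LinearMap.toMatrix (h.evalBasis T) (h.evalBasis T) φ.toLinearMap =
      Matrix.blockDiagonal' fun i => (1 : Matrix (Fin (r i)) (Fin (r i)) ℂ) ⊗ₖ
        LinearMap.toMatrix (T i) (T i) (llcomp _ _ _ φ) := by
  rw [← LinearEquiv.eq_symm_apply, LinearMap.toMatrix_symm]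
  refine (h.evalBasis T).ext fun ⟨i, a, k⟩ => ?_
  rw [Matrix.toLin_self, Fintype.sum_sigma, Finset.sum_eq_single i, Fintype.sum_prod_type,
    Finset.sum_eq_single a]
  · have h1 := DFunLike.congr_fun
      ((T i).sum_repr (llcomp _ _ _ φ (T i k))) (Pi.single a 1)
    rw [IntertwiningMap.sum_apply] at h1
    simp only [evalBasis_apply, Matrix.blockDiagonal'_apply_eq, Matrix.kroneckerMap_apply,
      Matrix.one_apply_eq, one_mul, LinearMap.toMatrix_apply]
    exact h1.symm
  · intro a' _ ha'
    simp [Matrix.one_apply_ne ha']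
  · simp
  · intro i' _ hi'
    simp [Matrix.blockDiagonal'_apply_ne _ _ _ hi']
  · simp

end Irreps

/-! ### Block-diagonal matrices; symmetry and transitivity of unitary equivalence -/

theorem toMatrix_piBasis_piMap {ι k : Type*} [Fintype ι] [DecidableEq ι] [CommRing k]
    {κ : ι → Type*} [∀ i, Fintype (κ i)] [∀ i, DecidableEq (κ i)] {V : ι → Type*}
    [∀ i, AddCommGroup (V i)] [∀ i, Module k (V i)] (b : ∀ i, Module.Basis (κ i) k (V i))
    (f : ∀ i, V i →ₗ[k] V i) :
    LinearMap.toMatrix (Pi.basis b) (Pi.basis b)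
        (LinearMap.pi fun i => f i ∘ₗ LinearMap.proj i) =
      Matrix.blockDiagonal' fun i => LinearMap.toMatrix (b i) (b i) (f i) := by
  ext ⟨i, a⟩ ⟨j, c⟩
  rw [LinearMap.toMatrix_apply, Pi.basis_apply, Pi.basis_repr]
  obtain rfl | hij := eq_or_ne i j
  · simp [LinearMap.toMatrix_apply, Matrix.blockDiagonal'_apply_eq]
  · simp [Matrix.blockDiagonal'_apply_ne _ _ _ hij, Pi.single_eq_of_ne hij]

theorem UnitarilyEquivalent.symm {m n : Type*} [Fintype m] [Fintype n] [DecidableEq m]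
    [DecidableEq n] {A : Matrix m m ℂ} {B : Matrix n n ℂ} (h : UnitarilyEquivalent A B) :
    UnitarilyEquivalent B A := by
  obtain ⟨U, hU, hU', rfl⟩ := h
  refine ⟨U.conjTranspose, by simpa using hU', by simpa using hU, ?_⟩
  rw [Matrix.conjTranspose_conjTranspose, Matrix.mul_assoc, Matrix.mul_assoc, hU, Matrix.mul_one,
    ← Matrix.mul_assoc, hU, Matrix.one_mul]

theorem UnitarilyEquivalent.trans {l m n : Type*} [Fintype l] [Fintype m] [Fintype n]
    [DecidableEq l] [DecidableEq m] [DecidableEq n] {A : Matrix l l ℂ} {B : Matrix m m ℂ}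
    {C : Matrix n n ℂ} (h : UnitarilyEquivalent A B) (h' : UnitarilyEquivalent B C) :
    UnitarilyEquivalent A C := by
  obtain ⟨U, hU, hU', rfl⟩ := h
  obtain ⟨V, hV, hV', rfl⟩ := h'
  refine ⟨U * V, ?_, ?_, ?_⟩
  · rw [Matrix.conjTranspose_mul, Matrix.mul_assoc, ← Matrix.mul_assoc _ U, hU, Matrix.one_mul, hV]
  · rw [Matrix.conjTranspose_mul, Matrix.mul_assoc, ← Matrix.mul_assoc V, hV', Matrix.one_mul, hU']
  · simp only [Matrix.conjTranspose_mul, Matrix.mul_assoc]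

/-! ### The three statements on quotient operators -/

section QuotientOperators

open Representation Representation.IntertwiningMap

variable {G : Type*} [Group G] {p : ℕ} {π : G →* Matrix.GeneralLinearGroup (Fin p) ℂ}
  {Op : Matrix (Fin p) (Fin p) ℂ}

/-- Pre-composition and restriction to summands commute with post-composition by definition, so both
naturality conditions are `rfl`; the same happens for induction and for the regular representation.
-/
theorem unitarilyEquivalent_quotientOp_of_directSum
    (hπ : ∀ g : G, (π g : Matrix (Fin p) (Fin p) ℂ) ∈ Matrix.unitaryGroup (Fin p) ℂ)
    (hOp : IsPiSymmetric π Op) {ι : Type*} [Fintype ι] [DecidableEq ι] {r : ι → ℕ}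
    {ρ : ∀ i, G →* Matrix.GeneralLinearGroup (Fin (r i)) ℂ} {s : ℕ}
    {R : G →* Matrix.GeneralLinearGroup (Fin s) ℂ}
    (f : (matRep R).Equiv (directSum fun i => matRep (ρ i))) {d : ι → ℕ}
    (b : ∀ i, OrthonormalBasis (Fin (d i)) ℂ (kernelSpace (ρ i) π)) {e : ℕ}
    (c : OrthonormalBasis (Fin e) ℂ (kernelSpace R π)) :
    UnitarilyEquivalent (quotientOp Op c)
      (Matrix.blockDiagonal' fun i => quotientOp Op (b i)) := by
  have hM {M : Matrix (Fin p) (Fin p) ℂ} (hM : IsPiSymmetric π M) :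
      LinearMap.toMatrix (Pi.basis fun i => homBasis (b i)) (Pi.basis fun i => homBasis (b i))
        (LinearMap.pi fun i => llcomp _ _ _ hM.intertwiningMap ∘ₗ LinearMap.proj i) =
      Matrix.blockDiagonal' fun i => quotientOp M (b i) := by
    rw [toMatrix_piBasis_piMap]
    simp_rw [toMatrix_homBasis_llcomp]
  refine .of_linearEquiv ((homCongrLeft f (matRep π)).symm.trans (homDirectSumEquiv _ _))
    (S := llcomp _ _ _ hOp.intertwiningMap)
    (S' := llcomp _ _ _ (hOp.conjTranspose hπ).intertwiningMap)
    (T := LinearMap.pi fun i => llcomp _ _ _ hOp.intertwiningMap ∘ₗ LinearMap.proj i)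
    (T' := LinearMap.pi fun i =>
      llcomp _ _ _ (hOp.conjTranspose hπ).intertwiningMap ∘ₗ LinearMap.proj i) (fun _ => rfl) (fun _ => rfl)
    (homBasis c) _ (toMatrix_homBasis_llcomp _ _) ?_ (hM hOp) ?_
  · rw [toMatrix_homBasis_llcomp, quotientOp_conjTranspose]
  · rw [hM (hOp.conjTranspose hπ), Matrix.blockDiagonal'_conjTranspose]
    simp_rw [quotientOp_conjTranspose]

theorem unitarilyEquivalent_quotientOp_of_ind
    (hπ : ∀ g : G, (π g : Matrix (Fin p) (Fin p) ℂ) ∈ Matrix.unitaryGroup (Fin p) ℂ)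
    (hOp : IsPiSymmetric π Op) {H : Type*} [Group H] (φ : H →* G) {s : ℕ}
    {σ : H →* Matrix.GeneralLinearGroup (Fin s) ℂ} {r : ℕ}
    {ρ : G →* Matrix.GeneralLinearGroup (Fin r) ℂ} (f : (matRep ρ).Equiv (ind φ (matRep σ)))
    {d : ℕ} (b : OrthonormalBasis (Fin d) ℂ (kernelSpace σ (π.comp φ))) {e : ℕ}
    (c : OrthonormalBasis (Fin e) ℂ (kernelSpace ρ π)) :
    UnitarilyEquivalent (quotientOp Op b) (quotientOp Op c) := by
  have hOp' := hOp.conjTranspose hπ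
  refine .symm (.of_linearEquiv
    ((homCongrLeft f (matRep π)).symm.trans (homIndEquiv φ (matRep σ) (matRep π)))
    (S := llcomp _ _ _ hOp.intertwiningMap) (S' := llcomp _ _ _ hOp'.intertwiningMap)
    (T := llcomp _ _ _ (hOp.comp φ).intertwiningMap)
    (T' := llcomp _ _ _ (hOp'.comp φ).intertwiningMap) (fun _ => rfl) (fun _ => rfl)
    (homBasis c) (homBasis b) (toMatrix_homBasis_llcomp _ _) ?_ (toMatrix_homBasis_llcomp _ _) ?_)
  · rw [toMatrix_homBasis_llcomp, quotientOp_conjTranspose]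
  · exact (toMatrix_homBasis_llcomp (hOp'.comp φ) b).trans (quotientOp_conjTranspose _ _)

theorem unitarilyEquivalent_quotientOp_of_leftRegular
    (hπ : ∀ g : G, (π g : Matrix (Fin p) (Fin p) ℂ) ∈ Matrix.unitaryGroup (Fin p) ℂ)
    (hOp : IsPiSymmetric π Op) {s : ℕ} {reg : G →* Matrix.GeneralLinearGroup (Fin s) ℂ}
    (f : (matRep reg).Equiv (leftRegular ℂ G)) {e : ℕ}
    (c : OrthonormalBasis (Fin e) ℂ (kernelSpace reg π)) :
    UnitarilyEquivalent Op (quotientOp Op c) := by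
  have hOp' := hOp.conjTranspose hπ
  refine .symm (.of_linearEquiv
    ((homCongrLeft f (matRep π)).symm.trans (homLeftRegularEquiv (matRep π)))
    (S := llcomp _ _ _ hOp.intertwiningMap) (S' := llcomp _ _ _ hOp'.intertwiningMap)
    (T := Matrix.toLin' Op) (T' := Matrix.toLin' Op.conjTranspose) (fun _ => rfl) (fun _ => rfl)
    (homBasis c) (Pi.basisFun ℂ (Fin p)) (toMatrix_homBasis_llcomp _ _) ?_ ?_ ?_)
  · rw [toMatrix_homBasis_llcomp, quotientOp_conjTranspose]
  · rw [LinearMap.toMatrix_eq_toMatrix', LinearMap.toMatrix'_toLin']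
  · rw [LinearMap.toMatrix_eq_toMatrix', LinearMap.toMatrix'_toLin']

theorem unitarilyEquivalent_blockDiagonal_irreps [Finite G]
    (hπ : ∀ g : G, (π g : Matrix (Fin p) (Fin p) ℂ) ∈ Matrix.unitaryGroup (Fin p) ℂ)
    (hOp : IsPiSymmetric π Op) {ι : Type*} [Fintype ι] [DecidableEq ι] {r : ι → ℕ}
    {ρ : ∀ i, G →* Matrix.GeneralLinearGroup (Fin (r i)) ℂ} (h : IsCompleteIrreps ρ) {d : ι → ℕ}
    (b : ∀ i, OrthonormalBasis (Fin (d i)) ℂ (kernelSpace (ρ i) π)) :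
    UnitarilyEquivalent Op (Matrix.blockDiagonal' fun i =>
      (1 : Matrix (Fin (r i)) (Fin (r i)) ℂ) ⊗ₖ quotientOp Op (b i)) := by
  have hM {M : Matrix (Fin p) (Fin p) ℂ} (hM : IsPiSymmetric π M) :
      LinearMap.toMatrix (h.evalBasis fun i => homBasis (b i))
        (h.evalBasis fun i => homBasis (b i)) (Matrix.toLin' M) =
      Matrix.blockDiagonal' fun i =>
        (1 : Matrix (Fin (r i)) (Fin (r i)) ℂ) ⊗ₖ quotientOp M (b i) := by
    simp_rw [← toMatrix_homBasis_llcomp hM, ← IsCompleteIrreps.toMatrix_evalBasis h]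
    rfl
  -- Only the basis changes, from the standard one to the evaluation basis. The latter need not be
  -- orthonormal, so the adjoint is checked in it separately.
  refine .of_linearEquiv (.refl ℂ _) (S := Matrix.toLin' Op)
    (S' := Matrix.toLin' Op.conjTranspose) (T := Matrix.toLin' Op)
    (T' := Matrix.toLin' Op.conjTranspose) (fun _ => rfl) (fun _ => rfl)
    (Pi.basisFun ℂ (Fin p)) _ ?_ ?_ (hM hOp) ?_
  · rw [LinearMap.toMatrix_eq_toMatrix', LinearMap.toMatrix'_toLin']
  · rw [LinearMap.toMatrix_eq_toMatrix', LinearMap.toMatrix'_toLin']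
  · rw [hM (hOp.conjTranspose hπ), Matrix.blockDiagonal'_conjTranspose]
    simp_rw [quotientOp_conjTranspose, Matrix.conjTranspose_kronecker, Matrix.conjTranspose_one]

end QuotientOperators

end

theorem mainTheorem3 {G : Type*} [Group G] [Finite G] {p : ℕ}
    (π : G →* Matrix.GeneralLinearGroup (Fin p) ℂ)
    (hπ : ∀ g : G, (π g : Matrix (Fin p) (Fin p) ℂ) ∈ Matrix.unitaryGroup (Fin p) ℂ)
    (Op : Matrix (Fin p) (Fin p) ℂ) (hOp : IsPiSymmetric π Op) :
    -- (1) additivity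
    (∀ (ι : Type*) [Fintype ι] [DecidableEq ι] (r : ι → ℕ)
        (ρ : ∀ i, G →* Matrix.GeneralLinearGroup (Fin (r i)) ℂ)
        (s : ℕ) (R : G →* Matrix.GeneralLinearGroup (Fin s) ℂ),
        Nonempty ((matRep R).Equiv (Representation.directSum fun i => matRep (ρ i))) →
        ∀ (d : ι → ℕ) (b : ∀ i, OrthonormalBasis (Fin (d i)) ℂ (kernelSpace (ρ i) π))
          (e : ℕ) (c : OrthonormalBasis (Fin e) ℂ (kernelSpace R π)),
          UnitarilyEquivalent (quotientOp Op c)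
            (Matrix.blockDiagonal' fun i => quotientOp Op (b i))) ∧
    -- (2) induction from a subgroup
    (∀ (H : Subgroup G) (s : ℕ) (σ : H →* Matrix.GeneralLinearGroup (Fin s) ℂ)
        (r : ℕ) (ρ : G →* Matrix.GeneralLinearGroup (Fin r) ℂ),
        Nonempty ((matRep ρ).Equiv (Representation.ind H.subtype (matRep σ))) →
        ∀ (d : ℕ) (b : OrthonormalBasis (Fin d) ℂ (kernelSpace σ (π.comp H.subtype)))
          (e : ℕ) (c : OrthonormalBasis (Fin e) ℂ (kernelSpace ρ π)),
          UnitarilyEquivalent (quotientOp Op b) (quotientOp Op c)) ∧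
    -- (3) the regular representation and the decomposition over all irreducibles
    (∀ (s : ℕ) (reg : G →* Matrix.GeneralLinearGroup (Fin s) ℂ),
        Nonempty ((matRep reg).Equiv (Representation.leftRegular ℂ G)) →
        ∀ (e : ℕ) (c : OrthonormalBasis (Fin e) ℂ (kernelSpace reg π)),
          UnitarilyEquivalent Op (quotientOp Op c) ∧
          ∀ (ι : Type*) (r : ι → ℕ) (ρ : ∀ i, G →* Matrix.GeneralLinearGroup (Fin (r i)) ℂ),
            IsCompleteIrreps ρ →
            ∀ (d : ι → ℕ) (b : ∀ i, OrthonormalBasis (Fin (d i)) ℂ (kernelSpace (ρ i) π)),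
              Finite ι ∧ ∀ [Fintype ι] [DecidableEq ι],
                UnitarilyEquivalent (quotientOp Op c)
                  (Matrix.blockDiagonal' fun i =>
                    (1 : Matrix (Fin (r i)) (Fin (r i)) ℂ) ⊗ₖ quotientOp Op (b i))) := by
  refine ⟨?_, ?_, ?_⟩
  · rintro ι _ _ r ρ s R ⟨f⟩ d b e c
    exact unitarilyEquivalent_quotientOp_of_directSum hπ hOp f b c
  · rintro H s σ r ρ ⟨f⟩ d b e c
    exact unitarilyEquivalent_quotientOp_of_ind hπ hOp H.subtype f b c
  · rintro s reg ⟨f⟩ e c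
    have hreg := unitarilyEquivalent_quotientOp_of_leftRegular hπ hOp f c
    refine ⟨hreg, fun ι r ρ h d b => ⟨h.finite, ?_⟩⟩
    intro _ _
    exact hreg.symm.trans (unitarilyEquivalent_blockDiagonal_irreps hπ hOp h b)
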